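/- Let $D=(V,A)$ be a finite directed graph (parallel arcs and loops allowed) in which every arc $a$ has a capacity $u_a>0$, a transit time $\tau_a\ge 0$ and a cost coefficient $c_a\in\mathbb R$, and suppose that costs are conservative, i.e. $D$ has no directed cycle of negative cost. Let $s\neq t$ be nodes and let $b>0$. Paths and cycles are simple and directed. An $s$-$t$-flow over time with time horizon $\theta$ consists of Lebesgue-measurable inflow rates $f_a:[0,\theta-\tau_a)\to[0,u_a]$, $a\in A$, such that no node other than $s$ has a flow deficit at any time in $[0,\theta]$, no node other than $s,t$ has a flow surplus at time $\theta$, and at time $\theta$ the net amount of flow that has left $s$, and the net amount that has arrived in $t$, is $b$. In addition, one of two models is fixed: either flow may be stored temporarily at intermediate nodes, or nodes other than $s,t$ never have a surplus. The amount on arc $a$ is $x_a=\int_0^{\theta-\tau_a}f_a$ and the cost is $\sum_a c_a x_a$. A flow over time has minimum cost if its cost is minimum among all $s$-$t$-flows over time sending $b$ units, with arbitrary time horizon. It is quickest if its time horizon is minimum among all such flows, and a quickest minimum cost flow if its time horizon is minimum among all minimum cost flows. Let $D'=(V,A')$, where $A'$ is the set of arcs that lie on some cheapest $s$-$t$-path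 in $D$. Then the following hold in either model. (1) For every $s$-$t$-flow over time $f$ sending $b$ units the following are equivalent: (i) $f$ has minimum cost; (ii) the amounts $x_a$ are composed of nonnegative amounts sent along cheapest $s$-$t$-paths and along cycles of cost zero; (iii) $f_a=0$ almost everywhere for every arc $a$ that lies neither on a cheapest $s$-$t$-path nor on a cycle of cost zero. (2) If $D$ has no cycle of cost zero, then for every such $f$ the following are equivalent: (i) $f$ has minimum cost; (ii) the amounts $x_a$ are composed of nonnegative amounts sent along cheapest $s$-$t$-paths; (iii) $f_a=0$ almost everywhere for every $a\notin A'$. (3) Every quickest $s$-$t$-flow over time sending $b$ units in $D'$, extended by zero to the arcs in $A\setminus A'$, is a quickest minimum cost $s$-$t$-flow in $D$ (zero-cost cycles are allowed here). If $D$ contains an $s$-$t$-path, then a quickest $s$-$t$-flow sending $b$ units in $D'$ exists. -/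

import Mathlib

/-- A network on a directed graph with node set `V` and arc set `A`: every arc has a tail, a head,
a positive capacity, a nonnegative transit time and a cost coefficient. Parallel arcs and loops
are allowed. -/
structure Network (V A : Type*) where
  tail : A → V
  head : A → V
  cap : A → ℝ
  transit : A → ℝ
  cost : A → ℝ
  cap_pos : ∀ a, 0 < cap a
  transit_nonneg : ∀ a, 0 ≤ transit a

namespace Network

variable {V A : Type*}

/-- The list of arcs `p` is a walk from `v` to `w`. -/
def IsWalk (D : Network V A) : V → List A → V → Prop
  | v, [], w => v = w
  | v, a :: p, w => D.tail a = v ∧ D.IsWalk (D.head a) p w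

/-- The list of arcs `p` is a (simple) path from `v` to `w`: no node is visited twice. -/
def IsPath (D : Network V A) (v : V) (p : List A) (w : V) : Prop :=
  D.IsWalk v p w ∧ (v :: p.map D.head).Nodup

/-- The list of arcs `p` is a (simple, directed) cycle. -/
def IsCycle (D : Network V A) (p : List A) : Prop :=
  p ≠ [] ∧ (∃ v, D.IsWalk v p v) ∧ (p.map D.head).Nodup

/-- The total cost of a list of arcs. -/
def listCost (D : Network V A) (p : List A) : ℝ := (p.map D.cost).sum

/-- Conservative costs: there is no cycle of negative cost. -/
def Conservative (D : Network V A) : Prop := ∀ p, D.IsCycle p → 0 ≤ D.listCost p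

/-- `p` is a cheapest path from `s` to `t`. -/
def IsCheapestPath (D : Network V A) (s t : V) (p : List A) : Prop :=
  D.IsPath s p t ∧ ∀ q, D.IsPath s q t → D.listCost p ≤ D.listCost q

/-- `p` is a cycle of cost zero. -/
def IsZeroCycle (D : Network V A) (p : List A) : Prop := D.IsCycle p ∧ D.listCost p = 0

open Classical in
/-- The set of all arcs that lie on some cheapest path from `s` to `t`. -/
noncomputable def cheapestArcs [Fintype A] (D : Network V A) (s t : V) : Finset A :=
  {a | ∃ p, D.IsCheapestPath s t p ∧ a ∈ p}

/-- The subnetwork of `D` with the same nodes and with arc set `B`. -/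
def restrict (D : Network V A) (B : Finset A) : Network V B where
  tail a := D.tail a
  head a := D.head a
  cap a := D.cap a
  transit a := D.transit a
  cost a := D.cost a
  cap_pos a := D.cap_pos a
  transit_nonneg a := D.transit_nonneg a

/-- The cheapest-paths network. -/
noncomputable def cheapestPathsNetwork [Fintype A] (D : Network V A) (s t : V) :
    Network V (D.cheapestArcs s t) :=
  D.restrict (D.cheapestArcs s t)

open Classical in
/-- Inflow rates given on the arcs in `B` only, regarded as inflow rates on all arcs. -/
noncomputable def extendByZero {B : Finset A} (f : B → ℝ → ℝ) (a : A) : ℝ → ℝ :=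
  if h : a ∈ B then f ⟨a, h⟩ else 0

open Classical in
/-- The arc amounts `x` are composed of nonnegative amounts sent along finitely many
members (paths or cycles, given as lists of arcs) of `Q`. -/
def SentAlong (x : A → ℝ) (Q : Set (List A)) : Prop :=
  ∃ (P : Finset (List A)) (w : List A → ℝ), (∀ p ∈ P, p ∈ Q ∧ 0 ≤ w p) ∧
    ∀ a, x a = ∑ p ∈ P, if a ∈ p then w p else 0

variable [Fintype A] [DecidableEq V]

/-- The amount of flow that has arrived in `v` up to time `x`, minus the amount of flow that has
left `v` up to time `x`, where `f a y` is the flow rate entering arc `a` at time `y`. -/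
noncomputable def excess (D : Network V A) (f : A → ℝ → ℝ) (v : V) (x : ℝ) : ℝ :=
  (∑ a with D.head a = v, ∫ y in Set.Ico 0 (x - D.transit a), f a y) -
    ∑ a with D.tail a = v, ∫ y in Set.Ico 0 x, f a y

/-- `f` is a flow over time with time horizon `θ` in `D` that sends `b` units of flow from `s`
to `t`. The rates `f a`, which live on `[0, θ - τ_a)`, are extended by zero to the real line.
If `storage` is `true`, flow may be stored temporarily at all nodes; if it is `false`, it may not be
stored at nodes other than `s` and `t`. -/
structure IsFlow (D : Network V A) (storage : Bool) (s t : V) (b θ : ℝ) (f : A → ℝ → ℝ) :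
    Prop where
  /-- Almost everywhere measurable for the Lebesgue measure, which is the same as
  Lebesgue measurable. -/
  measurable : ∀ a, AEMeasurable (f a) MeasureTheory.volume
  nonneg : ∀ a x, 0 ≤ f a x
  le_cap : ∀ a x, f a x ≤ D.cap a
  eq_zero : ∀ a x, x ∉ Set.Ico 0 (θ - D.transit a) → f a x = 0
  /-- No deficit at any point in time, except at the source. -/
  no_deficit : ∀ v, v ≠ s → ∀ x ∈ Set.Icc 0 θ, 0 ≤ D.excess f v x
  /-- No surplus at the time horizon, except at the sink (and the source). -/
  no_surplus : ∀ v, v ≠ s → v ≠ t → D.excess f v θ = 0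
  no_storage : storage = false → ∀ v, v ≠ s → v ≠ t → ∀ x ∈ Set.Icc 0 θ, D.excess f v x = 0
  supply : D.excess f s θ = -b
  demand : D.excess f t θ = b

/-- The total amount of flow that enters and traverses arc `a`. -/
noncomputable def amount {V A : Type*} (D : Network V A) (θ : ℝ) (f : A → ℝ → ℝ) (a : A) : ℝ :=
  ∫ y in Set.Ico 0 (θ - D.transit a), f a y

/-- The cost of a flow over time. -/
noncomputable def flowCost {V A : Type*} [Fintype A] (D : Network V A) (θ : ℝ) (f : A → ℝ → ℝ) : ℝ :=
  ∑ a, D.cost a * D.amount θ f a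

/-- `f`, with time horizon `θ`, has minimum cost among all flows over time, of any time horizon,
that send `b` units from `s` to `t`. -/
def IsMinCostFlow (D : Network V A) (storage : Bool) (s t : V) (b θ : ℝ) (f : A → ℝ → ℝ) : Prop :=
  D.IsFlow storage s t b θ f ∧
    ∀ θ' g, D.IsFlow storage s t b θ' g → D.flowCost θ f ≤ D.flowCost θ' g

/-- `f`, with time horizon `θ`, has minimum time horizon among all flows over time that send
`b` units from `s` to `t`. -/
def IsQuickestFlow (D : Network V A) (storage : Bool) (s t : V) (b θ : ℝ) (f : A → ℝ → ℝ) : Prop :=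
  D.IsFlow storage s t b θ f ∧ ∀ θ' g, D.IsFlow storage s t b θ' g → θ ≤ θ'

/-- `f`, with time horizon `θ`, has minimum time horizon among all minimum cost flows over time
that send `b` units from `s` to `t`. -/
def IsQuickestMinCostFlow (D : Network V A) (storage : Bool) (s t : V) (b θ : ℝ)
    (f : A → ℝ → ℝ) : Prop :=
  D.IsMinCostFlow storage s t b θ f ∧ ∀ θ' g, D.IsMinCostFlow storage s t b θ' g → θ ≤ θ'

end Network

/-! Shortest-path distances give a potential `π` with nonnegative reduced costs for which `π t - π
s` is the cost `m` of a cheapest path. Let `T` be the set of arcs of reduced cost zero. The cost of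
an s-t-path, of a cycle or of a flow of value `b` exceeds `m`, `0` or `b * m` by exactly its reduced
cost. Hence the cheapest paths and zero cycles are the s-t-paths and cycles inside `T`. The cost `b
* m` is attained along one cheapest path, so minimum cost means vanishing outside `T`
(`exists_tight_arcs`, `IsFlow.isMinCostFlow_iff`). Decomposing the arc amounts inside `T` into paths
and cycles (`sentAlong_of_static_flow`) gives the equivalences.

The statements on quickest flows rest on a max-flow min-cut argument over time. Consider the linear
program that packs s-t-paths of `T`, each valued by the time during which flow can enter it. Adding
optimal dual prices to the transit times gives arc lengths whose distances from `s`, truncated at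
the horizon, define a cut over time. Its capacity is the dual value, so `b` is at most the value of
an optimal packing (`IsFlow.exists_packing`). Conversely, a packing of value at least `b` yields a
temporally repeated flow (`exists_isFlow_of_packing`).

The bound uses no storage restriction and the construction stores nothing, so both models are
covered. The packing involves cheapest paths only, so neither zero cycles nor other tight arcs can
shorten the horizon. Compactness of the set of packings gives existence. -/

open MeasureTheory

namespace Network

variable {V A : Type*}

/-! ### Walks, shortest paths and potentials. -/

section Walks

variable {D : Network V A}

lemma isWalk_append {p q : List A} {v w : V} :
    D.IsWalk v (p ++ q) w ↔ ∃ u, D.IsWalk v p u ∧ D.IsWalk u q w := by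
  induction p generalizing v with
  | nil => simp [IsWalk]
  | cons a p ih => simp [IsWalk, ih, and_assoc]

lemma IsWalk.sum_sub {p : List A} {v w : V} (h : D.IsWalk v p w) (φ : V → ℝ) :
    (p.map fun a => φ (D.head a) - φ (D.tail a)).sum = φ w - φ v := by
  induction p generalizing v with
  | nil => simp only [IsWalk] at h; simp [h]
  | cons a p ih =>
    obtain ⟨rfl, h⟩ := h
    simp [ih h]

/-- The part of a walk up to a visited node, and the rest. -/
lemma IsWalk.exists_split {p : List A} {v w x : V} (h : D.IsWalk v p w)
    (hx : x ∈ v :: p.map D.head) :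
    ∃ p₁ p₂, p = p₁ ++ p₂ ∧ D.IsWalk v p₁ x ∧ D.IsWalk x p₂ w := by
  induction p generalizing v with
  | nil =>
    simp only [List.map_nil, List.mem_singleton] at hx
    subst hx
    exact ⟨[], [], rfl, rfl, h⟩
  | cons a p ih =>
    by_cases hxv : x = v
    · subst hxv
      exact ⟨[], a :: p, rfl, rfl, h⟩
    · obtain ⟨hv, h⟩ := h
      obtain ⟨p₁, p₂, rfl, h₁, h₂⟩ := ih h (by simpa [hxv] using hx)
      exact ⟨a :: p₁, p₂, rfl, ⟨hv, h₁⟩, h₂⟩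

lemma IsPath.nodup {p : List A} {v w : V} (h : D.IsPath v p w) : p.Nodup :=
  (List.nodup_cons.1 h.2).2.of_map

lemma IsCycle.nodup {p : List A} (h : D.IsCycle p) : p.Nodup := h.2.2.of_map

lemma IsPath.eq_nil {p : List A} {v : V} (h : D.IsPath v p v) : p = [] := by
  rcases List.eq_nil_or_concat p with rfl | ⟨q, a, rfl⟩
  · rfl
  · exfalso
    obtain ⟨h₁, h₂⟩ := h
    rw [List.concat_eq_append, isWalk_append] at h₁
    obtain ⟨u, -, -, h₁⟩ := h₁
    have : D.head a = v := h₁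
    simp [← this] at h₂

lemma finite_setOf_nodup [Finite A] : {p : List A | p.Nodup}.Finite := by
  classical
  have := Fintype.ofFinite A
  have : Finite {p : List A // p.Nodup} := inferInstance
  exact Set.finite_coe_iff.1 this

/-- A walk can be shortened to a path, which costs no more if there are no negative cycles. -/
lemma IsWalk.exists_isPath {c : A → ℝ} (hc : ∀ p, D.IsCycle p → 0 ≤ (p.map c).sum)
    {p : List A} {v w : V} (h : D.IsWalk v p w) :
    ∃ q, D.IsPath v q w ∧ q ⊆ p ∧ (q.map c).sum ≤ (p.map c).sum := by
  classical
  induction p generalizing v with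
  | nil => exact ⟨[], ⟨h, by simp⟩, by simp, le_rfl⟩
  | cons a p ih =>
    obtain ⟨hv, h⟩ := h
    obtain ⟨q, hq, hqp, hqc⟩ := ih h
    -- If the shortened path returns to `v`, its part up to `v` closes a cycle with `a`, and
    -- dropping that cycle does not raise the cost.
    by_cases hm : v ∈ D.head a :: q.map D.head
    · obtain ⟨q₁, q₂, rfl, h₁, h₂⟩ := hq.1.exists_split hm
      have hn := hq.2
      rw [List.map_append, ← List.cons_append, List.nodup_append] at hn
      have hcyc : D.IsCycle (a :: q₁) := ⟨by simp, ⟨v, hv, h₁⟩, hn.1⟩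
      have h0 := hc _ hcyc
      refine ⟨q₂, ⟨h₂, ?_⟩, ?_, ?_⟩
      · refine List.nodup_cons.2 ⟨fun hmem => ?_, hn.2.1⟩
        refine hn.2.2 v ?_ v hmem rfl
        -- `v` is the head of the last arc of `a :: q₁`, so `Nodup` excludes it from the heads in
        -- `q₂`.
        rcases List.eq_nil_or_concat q₁ with rfl | ⟨r, e, rfl⟩
        · have : D.head a = v := h₁
          simp [this]
        · rw [List.concat_eq_append, isWalk_append] at h₁
          obtain ⟨u, -, -, h₁⟩ := h₁
          have : D.head e = v := h₁
          simp [this]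
      · exact fun e he => List.mem_cons_of_mem _ (hqp (List.mem_append_right _ he))
      · simp only [List.map_append, List.map_cons, List.sum_append, List.sum_cons] at h0 hqc ⊢
        linarith
    · refine ⟨a :: q, ⟨⟨hv, hq.1⟩, ?_⟩, List.cons_subset_cons _ hqp, by simpa using hqc⟩
      exact List.nodup_cons.2 ⟨hm, hq.2⟩

lemma IsWalk.exists_isPath_subset {p : List A} {v w : V} (h : D.IsWalk v p w) :
    ∃ q, D.IsPath v q w ∧ q ⊆ p := by
  obtain ⟨q, hq, hqp, -⟩ := h.exists_isPath (c := fun _ => 0) (fun p _ => by simp)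
  exact ⟨q, hq, hqp⟩

lemma finite_setOf_isPath [Finite A] (v w : V) : {p | D.IsPath v p w}.Finite :=
  finite_setOf_nodup.subset fun _ hp => hp.nodup

lemma exists_isCheapestPath [Finite A] {s t : V} (h : ∃ p, D.IsPath s p t) :
    ∃ p, D.IsCheapestPath s t p := by
  obtain ⟨p, hp, hmin⟩ := Set.exists_min_image {p | D.IsPath s p t} D.listCost
    (finite_setOf_isPath s t) h
  exact ⟨p, hp, hmin⟩

/-- Distances with respect to costs without negative cycles, where starting in `v` costs `h v`. -/
lemma exists_potential [Finite V] [Finite A] {c : A → ℝ}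
    (hc : ∀ p, D.IsCycle p → 0 ≤ (p.map c).sum) (h : V → ℝ) :
    ∃ π : V → ℝ, (∀ a, π (D.head a) ≤ π (D.tail a) + c a) ∧ (∀ v, π v ≤ h v) ∧
      ∀ v, ∃ u p, D.IsPath u p v ∧ π v = h u + (p.map c).sum := by
  have key : ∀ v, ∃ x : V × List A, D.IsPath x.1 x.2 v ∧
      ∀ y : V × List A, D.IsPath y.1 y.2 v →
        h x.1 + (x.2.map c).sum ≤ h y.1 + (y.2.map c).sum := by
    intro v
    have hfin : {x : V × List A | D.IsPath x.1 x.2 v}.Finite :=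
      (Set.finite_univ.prod finite_setOf_nodup).subset fun x hx => ⟨trivial, IsPath.nodup hx⟩
    obtain ⟨x, hx, hmin⟩ := Set.exists_min_image _
      (fun x : V × List A => h x.1 + (x.2.map c).sum) hfin ⟨(v, []), rfl, by simp⟩
    exact ⟨x, hx, hmin⟩
  choose x hx hmin using key
  refine ⟨fun v => h (x v).1 + ((x v).2.map c).sum, fun a => ?_, fun v => ?_,
    fun v => ⟨_, _, hx v, rfl⟩⟩
  -- An optimal path to the tail, extended by `a`, may revisit a node; shortening it gives a
  -- competitor at the head.
  · have hw : D.IsWalk (x (D.tail a)).1 ((x (D.tail a)).2 ++ [a]) (D.head a) :=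
      isWalk_append.2 ⟨_, (hx (D.tail a)).1, rfl, rfl⟩
    obtain ⟨q, hq, -, hqc⟩ := hw.exists_isPath hc
    have := hmin (D.head a) (_, q) hq
    simp only [List.map_append, List.sum_append, List.map_cons, List.map_nil, List.sum_cons,
      List.sum_nil] at hqc this ⊢
    linarith
  · simpa using hmin v (v, []) ⟨rfl, by simp⟩

lemma sum_ite_mem_eq [Fintype A] [DecidableEq A] {p : List A} (hp : p.Nodup) (g : A → ℝ) :
    ∑ a, (if a ∈ p then g a else 0) = (p.map g).sum := by
  rw [← List.sum_toFinset g hp, ← Finset.sum_filter]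
  congr 1
  ext a
  simp

/-- A potential with nonnegative reduced costs for which all cheapest paths are tight. -/
lemma exists_tight_potential [Finite V] [Fintype A] (hD : D.Conservative) {s t : V} {p₀ : List A}
    (hp₀ : D.IsCheapestPath s t p₀) :
    ∃ π : V → ℝ, (∀ a, 0 ≤ D.cost a - (π (D.head a) - π (D.tail a))) ∧
      π t - π s = D.listCost p₀ := by
  classical
  set K : ℝ := ∑ a, |D.cost a| with hK
  have hbound : ∀ p : List A, p.Nodup → |D.listCost p| ≤ K := by
    intro p hp
    rw [listCost, ← sum_ite_mem_eq hp]
    refine (Finset.abs_sum_le_sum_abs _ _).trans (Finset.sum_le_sum fun a _ => ?_)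
    split_ifs <;> simp
  have hK0 : 0 ≤ K := Finset.sum_nonneg fun _ _ => abs_nonneg _
  -- The penalty `2 * K` keeps `π` finite at nodes unreachable from `s`. A simple path costs at
  -- least `-K`, so with another start the total is at least `K`, which undercuts neither `0` at `s`
  -- nor the cost of `p₀` at `t`.
  obtain ⟨π, h1, h2, h3⟩ := exists_potential (D := D) (c := D.cost) hD
    (fun u => if u = s then 0 else 2 * K)
  have hs : π s = 0 := by
    refine le_antisymm (by simpa using h2 s) ?_
    obtain ⟨u, p, hp, hπ⟩ := h3 s
    rw [hπ]
    split_ifs with hu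
    · subst hu
      simp [hp.eq_nil]
    · have := abs_le.1 (hbound p hp.nodup)
      simp only [listCost] at this
      linarith
  have ht : π t = D.listCost p₀ := by
    refine le_antisymm ?_ ?_
    · have := hp₀.1.1.sum_sub π
      have h4 : (p₀.map fun a => π (D.head a) - π (D.tail a)).sum ≤ (p₀.map D.cost).sum :=
        List.sum_le_sum fun a _ => by linarith [h1 a]
      simp only [listCost]
      linarith
    · obtain ⟨u, p, hp, hπ⟩ := h3 t
      rw [hπ]
      split_ifs with hu
      · subst hu
        simpa [listCost] using hp₀.2 p hp
      · have h5 := abs_le.1 (hbound p hp.nodup)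
        have h6 := abs_le.1 (hbound p₀ hp₀.1.nodup)
        simp only [listCost] at h5 h6 ⊢
        linarith
  exact ⟨π, fun a => by linarith [h1 a], by rw [hs, ht, sub_zero]⟩

end Walks

end Network

namespace Network

variable {V A : Type*}

/-! ### Decomposition of static flows, with conservation tested against functions on the nodes. -/

section Static

lemma SentAlong.add_single [DecidableEq A] {x : A → ℝ} {Q : Set (List A)} (h : SentAlong x Q)
    {q : List A} (hq : q ∈ Q) {ε : ℝ} (hε : 0 ≤ ε) :
    SentAlong (fun a => x a + if a ∈ q then ε else 0) Q := by
  classical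
  obtain ⟨P, w, hP, hx⟩ := h
  refine ⟨insert q P, fun p => (if p ∈ P then w p else 0) + if p = q then ε else 0, ?_, ?_⟩
  · intro p hp
    rw [Finset.mem_insert] at hp
    refine ⟨?_, add_nonneg ?_ ?_⟩
    · rcases hp with rfl | hp
      exacts [hq, (hP p hp).1]
    · split_ifs with h
      exacts [(hP p h).2, le_rfl]
    · split_ifs
      exacts [hε, le_rfl]
  · intro a
    have h1 : ∑ p ∈ insert q P, (if a ∈ p then (if p ∈ P then w p else 0) else 0) =
        ∑ p ∈ P, if a ∈ p then w p else 0 := by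
      rw [← Finset.sum_subset (Finset.subset_insert q P)]
      · exact Finset.sum_congr rfl fun p hp => by simp [hp]
      · intro p _ hp
        simp [hp]
    have h2 : ∑ p ∈ insert q P, (if a ∈ p then (if p = q then ε else 0) else 0) =
        if a ∈ q then ε else 0 := by
      rw [Finset.sum_eq_single_of_mem q (Finset.mem_insert_self q P)]
      · simp
      · intro p _ hp
        simp [hp]
    have h3 : x a = ∑ p ∈ P, if a ∈ p then w p else 0 := by
      rw [hx a]
      exact Finset.sum_congr rfl fun p _ => by congr
    dsimp only
    rw [h3, ← h1]
    simp only [← h2, ← Finset.sum_add_distrib]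
    refine Finset.sum_congr rfl fun p _ => ?_
    split_ifs <;> simp

lemma sentAlong_zero (Q : Set (List A)) : SentAlong (fun _ => 0) Q :=
  ⟨∅, 0, by simp, by simp⟩

lemma exists_min_on_list {x : A → ℝ} {p : List A} (hp : p ≠ []) :
    ∃ e ∈ p, ∀ a ∈ p, x e ≤ x a := by
  classical
  obtain ⟨e, he, h⟩ := Finset.exists_min_image p.toFinset x (by simpa using hp)
  exact ⟨e, by simpa using he, fun a ha => h a (by simpa using ha)⟩

variable [Fintype A] {D : Network V A}

lemma IsWalk.sum_ite_mem [DecidableEq A] {p : List A} {v w : V} (h : D.IsWalk v p w)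
    (hp : p.Nodup) (φ : V → ℝ) (ε : ℝ) :
    ∑ a, (if a ∈ p then ε else 0) * (φ (D.head a) - φ (D.tail a)) = ε * (φ w - φ v) := by
  rw [← h.sum_sub φ, ← sum_ite_mem_eq hp, Finset.mul_sum]
  exact Finset.sum_congr rfl fun a _ => by split_ifs <;> simp

/-- The support of a flow of positive value from `s` to `t` contains a path from `s` to `t`. -/
lemma exists_isPath_of_sum_eq {x : A → ℝ} (hx : ∀ a, 0 ≤ x a) {b : ℝ} {s t : V}
    (hcons : ∀ φ : V → ℝ, ∑ a, x a * (φ (D.head a) - φ (D.tail a)) = b * (φ t - φ s))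
    (hb : 0 < b) : ∃ p, D.IsPath s p t ∧ ∀ a ∈ p, 0 < x a := by
  classical
  by_contra! hno
  -- Conservation is tested against the indicator of the nodes reachable through the support: no arc
  -- carrying flow leaves `R`, so the left side is nonnegative, while the right side is `-b`.
  let R : Set V := {v | ∃ p, D.IsWalk s p v ∧ ∀ a ∈ p, 0 < x a}
  have hs : s ∈ R := ⟨[], rfl, by simp⟩
  have ht : t ∉ R := by
    rintro ⟨p, hp, hpx⟩
    obtain ⟨q, hq, hqp⟩ := hp.exists_isPath_subset
    obtain ⟨a, ha, hax⟩ := hno q hq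
    exact absurd (hpx a (hqp ha)) (not_lt.2 hax)
  have h := hcons (R.indicator 1)
  have h0 : 0 ≤ ∑ a, x a * (R.indicator (1 : V → ℝ) (D.head a) - R.indicator 1 (D.tail a)) := by
    refine Finset.sum_nonneg fun a _ => ?_
    rcases (hx a).eq_or_lt with ha | ha
    · simp [← ha]
    · refine mul_nonneg ha.le ?_
      by_cases hta : D.tail a ∈ R
      · have : D.head a ∈ R := by
          obtain ⟨p, hp, hpx⟩ := hta
          refine ⟨p ++ [a], isWalk_append.2 ⟨_, hp, rfl, rfl⟩, ?_⟩
          intro e he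
          rcases List.mem_append.1 he with he | he
          · exact hpx e he
          · rw [List.mem_singleton.1 he]
            exact ha
        simp [hta, this]
      · simp only [Set.indicator_of_notMem hta, sub_zero]
        exact Set.indicator_nonneg (by simp) _
  rw [h] at h0
  simp only [Set.indicator_of_notMem ht, Set.indicator_of_mem hs, Pi.one_apply] at h0
  linarith

/-- The support of a nonzero circulation contains a cycle. -/
lemma exists_isCycle_of_sum_eq_zero {x : A → ℝ} (hx : ∀ a, 0 ≤ x a)
    (hcons : ∀ φ : V → ℝ, ∑ a, x a * (φ (D.head a) - φ (D.tail a)) = 0)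
    {e : A} (he : 0 < x e) : ∃ p, D.IsCycle p ∧ ∀ a ∈ p, 0 < x a := by
  classical
  -- Without `e`, the circulation is a flow of value `x e` from the head of `e` to its tail; a path
  -- in its support closes up with `e`.
  let y : A → ℝ := fun a => if a = e then 0 else x a
  have hy : ∀ a, 0 ≤ y a := fun a => by
    simp only [y]
    split_ifs
    exacts [le_rfl, hx a]
  have hcons' : ∀ φ : V → ℝ, ∑ a, y a * (φ (D.head a) - φ (D.tail a)) =
      x e * (φ (D.tail e) - φ (D.head e)) := by
    intro φ
    have h1 : ∀ a, y a * (φ (D.head a) - φ (D.tail a)) = x a * (φ (D.head a) - φ (D.tail a)) -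
        if a = e then x e * (φ (D.head e) - φ (D.tail e)) else 0 := by
      intro a
      simp only [y]
      split_ifs with h
      · subst h; ring
      · ring
    simp only [h1, Finset.sum_sub_distrib, hcons φ, Finset.sum_ite_eq', Finset.mem_univ, if_true]
    ring
  obtain ⟨p, hp, hpy⟩ := exists_isPath_of_sum_eq hy hcons' he
  refine ⟨e :: p, ⟨by simp, ⟨_, rfl, hp.1⟩, hp.2⟩, ?_⟩
  intro a ha
  rcases List.mem_cons.1 ha with rfl | ha
  · exact he
  · have := hpy a ha
    simp only [y] at this
    split_ifs at this with h
    · exact absurd this (lt_irrefl _)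
    · exact this

/-- Subtracting along a list of arcs as much as one of them carries makes the support smaller. -/
lemma card_support_sub_lt {x : A → ℝ} [DecidableEq A] {p : List A} {ε : ℝ} {e : A} (he : e ∈ p)
    (hxe : x e = ε) (hε : 0 < ε) :
    (Finset.univ.filter fun a => 0 < x a - if a ∈ p then ε else 0).card <
      (Finset.univ.filter fun a => 0 < x a).card := by
  refine Finset.card_lt_card (Finset.ssubset_iff_subset_ne.2 ⟨fun a ha => ?_, fun h => ?_⟩)
  · simp only [Finset.mem_filter, Finset.mem_univ, true_and] at ha ⊢
    split_ifs at ha <;> linarith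
  · have : e ∈ Finset.univ.filter fun a => 0 < x a := by simp [hxe, hε]
    rw [← h] at this
    simp [he, hxe] at this

/-- Decomposition of circulations into cycles. -/
lemma sentAlong_of_circulation {T : Set A} {Q : Set (List A)}
    (hQ : ∀ p, D.IsCycle p → (∀ a ∈ p, a ∈ T) → p ∈ Q) {x : A → ℝ} (hx : ∀ a, 0 ≤ x a)
    (hT : ∀ a, 0 < x a → a ∈ T)
    (hcons : ∀ φ : V → ℝ, ∑ a, x a * (φ (D.head a) - φ (D.tail a)) = 0) : SentAlong x Q := by
  classical
  induction hn : (Finset.univ.filter fun a => 0 < x a).card using Nat.strong_induction_on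
    generalizing x with
  | _ n ih =>
    subst hn
    by_cases h0 : ∃ e, 0 < x e
    · obtain ⟨e, he⟩ := h0
      obtain ⟨p, hp, hpx⟩ := exists_isCycle_of_sum_eq_zero hx hcons he
      obtain ⟨e, he, hmin⟩ := exists_min_on_list (x := x) hp.1
      obtain ⟨v, hv⟩ := hp.2.1
      have := ih _ (card_support_sub_lt he rfl (hpx e he))
        (x := fun a => x a - if a ∈ p then x e else 0) ?_ ?_ ?_ rfl
      · have := this.add_single (hQ p hp fun a ha => hT a (hpx a ha)) (hx e)
        simpa using this
      · intro a
        split_ifs with ha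
        · linarith [hmin a ha]
        · linarith [hx a]
      · intro a ha
        refine hT a ?_
        split_ifs at ha <;> linarith [hx e]
      · intro φ
        simp only [sub_mul, Finset.sum_sub_distrib]
        rw [hcons, hv.sum_ite_mem hp.nodup]
        simp
    · push Not at h0
      rw [show x = fun _ => 0 from funext fun a => le_antisymm (h0 a) (hx a)]
      exact sentAlong_zero Q

/-- Decomposition of flows into paths and cycles. -/
lemma sentAlong_of_static_flow {T : Set A} {Q : Set (List A)} {s t : V} (hst : s ≠ t)
    (hQ : ∀ p, D.IsCycle p → (∀ a ∈ p, a ∈ T) → p ∈ Q)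
    (hQ' : ∀ p, D.IsPath s p t → (∀ a ∈ p, a ∈ T) → p ∈ Q) {x : A → ℝ} (hx : ∀ a, 0 ≤ x a)
    (hT : ∀ a, 0 < x a → a ∈ T) {b : ℝ} (hb : 0 ≤ b)
    (hcons : ∀ φ : V → ℝ, ∑ a, x a * (φ (D.head a) - φ (D.tail a)) = b * (φ t - φ s)) :
    SentAlong x Q := by
  classical
  induction hn : (Finset.univ.filter fun a => 0 < x a).card using Nat.strong_induction_on
    generalizing x b with
  | _ n ih =>
    subst hn
    rcases hb.eq_or_lt with rfl | hb0
    · exact sentAlong_of_circulation hQ hx hT (by simpa using hcons)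
    · obtain ⟨p, hp, hpx⟩ := exists_isPath_of_sum_eq hx hcons hb0
      have hne : p ≠ [] := by
        rintro rfl
        exact hst hp.1
      obtain ⟨e, he, hmin⟩ := exists_min_on_list (x := x) hne
      have hpQ := hQ' p hp fun a ha => hT a (hpx a ha)
      have hpos := hpx e he
      have h1 : ∀ ε, 0 ≤ ε → ε ≤ x e → ∀ a, 0 ≤ x a - if a ∈ p then ε else 0 := by
        intro ε _ hε' a
        split_ifs with ha
        · linarith [hmin a ha]
        · linarith [hx a]
      have h2 : ∀ ε, 0 ≤ ε → ∀ a, 0 < (x a - if a ∈ p then ε else 0) → a ∈ T := by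
        intro ε hε a ha
        refine hT a ?_
        split_ifs at ha <;> linarith
      have h3 : ∀ (ε : ℝ) (φ : V → ℝ), ∑ a, (x a - if a ∈ p then ε else 0) *
          (φ (D.head a) - φ (D.tail a)) = (b - ε) * (φ t - φ s) := by
        intro ε φ
        simp only [sub_mul, Finset.sum_sub_distrib]
        rw [hcons, hp.1.sum_ite_mem hp.nodup]
      -- If the bottleneck exceeds the remaining value, only `b` is subtracted. The support need not
      -- shrink then, but what is left is a circulation.
      rcases le_or_gt (x e) b with hle | hlt
      · have := ih _ (card_support_sub_lt he rfl hpos) (h1 _ hpos.le le_rfl) (h2 _ hpos.le)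
          (sub_nonneg.2 hle) (h3 _) rfl
        simpa using this.add_single hpQ hpos.le
      · have := sentAlong_of_circulation hQ (h1 b hb0.le hlt.le) (h2 b hb0.le)
          (fun φ => by rw [h3]; simp)
        simpa using this.add_single hpQ hb0.le

end Static

end Network

/-! ### Linear programming duality by separation of convex sets. -/

/-- Strong duality for packing problems with positive capacities: if `v` bounds the value of every
packing, then there is a dual solution of value at most `v`. -/
lemma exists_dual_of_packing_le {ι A : Type*} [Fintype A] (P : Finset ι) (inc : ι → A → ℝ)
    {u : A → ℝ} (hu : ∀ a, 0 < u a) (l : ι → ℝ) (v : ℝ)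
    (hv : ∀ w : ι → ℝ, (∀ p, 0 ≤ w p) → (∀ a, ∑ p ∈ P, w p * inc p a ≤ u a) →
      ∑ p ∈ P, w p * l p ≤ v) :
    ∃ z : A → ℝ, (∀ a, 0 ≤ z a) ∧ ∑ a, u a * z a ≤ v ∧ ∀ p ∈ P, l p ≤ ∑ a, inc p a * z a := by
  classical
  -- `S₁` holds the pairs of loads strictly below capacity and values above `v`, and `S₂` is the
  -- cone of attainable pairs. The bound `hv` makes them disjoint, and the normal of a separating
  -- hyperplane is the dual solution up to scaling.
  let S₁ : Set ((A → ℝ) × ℝ) := (Set.pi Set.univ fun a => Set.Iio (u a)) ×ˢ Set.Ioi v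
  let S₂ : Set ((A → ℝ) × ℝ) := {x | ∃ w : ι → ℝ, (∀ p, 0 ≤ w p) ∧
    x = (fun a => ∑ p ∈ P, w p * inc p a, ∑ p ∈ P, w p * l p)}
  have hS₁ : Convex ℝ S₁ :=
    (convex_pi fun a _ => convex_Iio (u a)).prod (convex_Ioi v)
  have hS₁o : IsOpen S₁ :=
    (isOpen_set_pi Set.finite_univ fun a _ => isOpen_Iio).prod isOpen_Ioi
  have hS₂ : Convex ℝ S₂ := by
    rintro _ ⟨w, hw, rfl⟩ _ ⟨w', hw', rfl⟩ α β hα hβ -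
    refine ⟨fun p => α * w p + β * w' p, fun p => by have := hw p; have := hw' p; positivity, ?_⟩
    ext
    · simp [Finset.mul_sum, ← Finset.sum_add_distrib, add_mul, mul_assoc]
    · simp [Finset.mul_sum, ← Finset.sum_add_distrib, add_mul, mul_assoc]
  have hdisj : Disjoint S₁ S₂ := by
    rw [Set.disjoint_left]
    rintro _ ⟨h1, h2⟩ ⟨w, hw, rfl⟩
    exact absurd (hv w hw fun a => (h1 a trivial).le) (not_le.2 h2)
  obtain ⟨F, k, hF₁, hF₂⟩ := geometric_hahn_banach_open hS₁ hS₁o hS₂ hdisj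
  have hk : k ≤ 0 := by
    have := hF₂ 0 ⟨0, by simp, by ext <;> simp⟩
    simpa using this
  let α : A → ℝ := fun a => F (Pi.single a 1, 0)
  let β : ℝ := -F (0, 1)
  have hF : ∀ g r, F (g, r) = ∑ a, g a * α a - β * r := by
    intro g r
    have h1 : (g, r) = ∑ a, g a • ((Pi.single a 1 : A → ℝ), (0 : ℝ)) + r • ((0 : A → ℝ), (1:ℝ)) := by
      ext i
      · simp [Prod.fst_sum, Finset.sum_apply, Pi.single_apply]
      · simp [Prod.snd_sum]
    rw [h1, map_add, map_sum]
    simp only [map_smul, smul_eq_mul, α, β]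
    ring
  have hneg : ∀ (g : A → ℝ) (r : ℝ), (∀ a, g a < u a) → v < r → ∑ a, g a * α a < β * r := by
    intro g r hg hr
    have := hF₁ (g, r) ⟨fun a _ => hg a, hr⟩
    rw [hF] at this
    linarith
  -- a linear function that is bounded above on a ray does not grow along it
  have hray : ∀ c d : ℝ, (∀ n : ℝ, 0 ≤ n → c + n * d < 0) → d ≤ 0 := by
    intro c d h
    by_contra! hd
    have h0 := h (|c| / d) (by positivity)
    rw [div_mul_cancel₀ _ hd.ne'] at h0
    linarith [neg_abs_le c]
  -- From the point `(u - 1, v + 1)`, `S₁` extends indefinitely to smaller loads and larger values,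
  -- which forces the signs of `α` and `β`.
  have hα : ∀ a, 0 ≤ α a := by
    intro a
    have : -α a ≤ 0 := by
      refine hray (∑ e, (u e - 1) * α e - β * (v + 1)) _ fun n hn => ?_
      have := hneg (fun e => u e - 1 + (Pi.single a (-n) : A → ℝ) e) (v + 1) (fun e => ?_) (by linarith)
      · simp only [add_mul, Finset.sum_add_distrib] at this
        have h2 : ∑ e, (Pi.single a (-n) : A → ℝ) e * α e = -n * α a := by
          simp [Pi.single_apply]
        rw [h2] at this
        linarith
      · have : (Pi.single a (-n) : A → ℝ) e ≤ 0 := by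
          rw [Pi.single_apply]
          split_ifs <;> linarith
        linarith
    linarith
  have hβ0 : 0 ≤ β := by
    have : -β ≤ 0 := by
      refine hray (∑ e, (u e - 1) * α e - β * (v + 1)) _ fun n hn => ?_
      have := hneg (fun e => u e - 1) (v + 1 + n) (fun e => by linarith) (by linarith)
      linarith
    linarith
  have hlim : ∑ a, u a * α a ≤ β * v := by
    have key : ∀ ε : ℝ, 0 < ε → ∑ a, u a * α a ≤ β * v + ε * (∑ a, α a + β) := by
      intro ε hε
      have := hneg (fun e => u e - ε) (v + ε) (fun e => by linarith) (by linarith)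
      simp only [sub_mul, Finset.sum_sub_distrib, ← Finset.mul_sum] at this
      linarith
    have hC : 0 ≤ ∑ a, α a + β := add_nonneg (Finset.sum_nonneg fun a _ => hα a) hβ0
    refine le_of_forall_pos_le_add fun δ hδ => ?_
    have := key (δ / (∑ a, α a + β + 1)) (by positivity)
    have h2 : δ / (∑ a, α a + β + 1) * (∑ a, α a + β) ≤ δ := by
      rw [div_mul_eq_mul_div, div_le_iff₀ (by positivity)]
      nlinarith
    linarith
  -- This is where positive capacities enter: `β = 0` would force `α = 0`, contradicting strict
  -- separation at `(0, v + 1)`.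
  have hβ : 0 < β := by
    refine hβ0.lt_of_ne fun h0 => ?_
    rw [← h0, zero_mul] at hlim
    have h1 : ∀ a ∈ Finset.univ, u a * α a = 0 := by
      refine (Finset.sum_eq_zero_iff_of_nonneg fun a _ => mul_nonneg (hu a).le (hα a)).1 ?_
      exact le_antisymm hlim (Finset.sum_nonneg fun a _ => mul_nonneg (hu a).le (hα a))
    have h2 : ∀ a, α a = 0 := fun a =>
      (mul_eq_zero.1 (h1 a (Finset.mem_univ a))).resolve_left (hu a).ne'
    have := hneg 0 (v + 1) (by simpa using hu) (by linarith)
    simp [← h0] at this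
  refine ⟨fun a => α a / β, fun a => div_nonneg (hα a) hβ0, ?_, ?_⟩
  · simp only [← mul_div_assoc]
    rw [← Finset.sum_div, div_le_iff₀ hβ]
    linarith
  · intro p hp
    simp only [← mul_div_assoc]
    rw [← Finset.sum_div, le_div_iff₀ hβ]
    -- Weight `n` on `p` alone lies in `S₂` for all `n ≥ 0`; a lower bound along this ray makes the
    -- slope nonnegative.
    have hcone : ∀ n : ℝ, 0 ≤ n → k ≤ n * (∑ a, inc p a * α a - β * l p) := by
      intro n hn
      have := hF₂ (fun a => n * inc p a, n * l p)
        ⟨fun q => if q = p then n else 0, fun q => by dsimp only; split_ifs <;> simp [hn], by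
          simp [hp]⟩
      rw [hF] at this
      rw [mul_sub, Finset.mul_sum]
      simp only [mul_assoc] at this
      linarith
    have : -(∑ a, inc p a * α a - β * l p) ≤ 0 := by
      refine hray (k - 1) _ fun n hn => ?_
      have := hcone n hn
      linarith
    linarith

/-! ### Packings of paths, valued by sending time. -/

namespace Network

variable {V A : Type*}

/-- The length of the time interval in which flow can be sent into a path in order to arrive by
time `θ`. -/
noncomputable def sendTime (D : Network V A) (θ : ℝ) (p : List A) : ℝ :=
  max 0 (θ - (p.map D.transit).sum)

/-- Nonnegative weights of the paths in `P` that respect all capacities. -/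
def packings [DecidableEq A] (D : Network V A) (P : Finset (List A)) : Set (List A → ℝ) :=
  {w | (∀ p, 0 ≤ w p) ∧ (∀ p, p ∉ P → w p = 0) ∧
    ∀ a, ∑ p ∈ P, w p * (if a ∈ p then 1 else 0) ≤ D.cap a}

section Packings

variable {D : Network V A} {P : Finset (List A)}

lemma sendTime_nonneg (θ : ℝ) (p : List A) : 0 ≤ D.sendTime θ p := le_max_left _ _

lemma continuous_sendTime (p : List A) : Continuous fun θ => D.sendTime θ p := by
  unfold sendTime
  fun_prop

/-- Each path in `P` has an arc whose capacity bounds its weight, and all other lists have weight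
zero, so the set is closed in a product of compact intervals. -/
lemma isCompact_packings [DecidableEq A] (hP : ∀ p ∈ P, p ≠ []) : IsCompact (D.packings P) := by
  classical
  have hle : ∀ w ∈ D.packings P, ∀ p ∈ P, ∀ a ∈ p, w p ≤ D.cap a := by
    rintro w ⟨h0, -, h2⟩ p hp a ha
    refine le_trans ?_ (h2 a)
    have := Finset.single_le_sum (f := fun p => w p * (if a ∈ p then (1 : ℝ) else 0))
      (fun q _ => mul_nonneg (h0 q) (by split_ifs <;> simp)) hp
    simpa [ha] using this
  choose e he using fun p (hp : p ∈ P) => List.exists_mem_of_ne_nil p (hP p hp)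
  have hK : IsCompact (Set.pi Set.univ fun p : List A =>
      Set.Icc (0 : ℝ) (if h : p ∈ P then D.cap (e p h) else 0)) :=
    isCompact_univ_pi fun p => isCompact_Icc
  refine hK.of_isClosed_subset ?_ ?_
  · simp only [packings, Set.ofPred_and, Set.ofPred_forall]
    refine IsClosed.inter ?_ (IsClosed.inter ?_ ?_)
    · exact isClosed_iInter fun p => isClosed_le continuous_const (continuous_apply p)
    · exact isClosed_iInter fun p => isClosed_iInter fun _ =>
        isClosed_eq (continuous_apply p) continuous_const
    · exact isClosed_iInter fun a => isClosed_le (by fun_prop) continuous_const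
  · rintro w hw p -
    refine ⟨hw.1 p, ?_⟩
    split_ifs with h
    · exact hle w hw p h _ (he p h)
    · exact (hw.2.1 p h).le

lemma zero_mem_packings [DecidableEq A] : (0 : List A → ℝ) ∈ D.packings P :=
  ⟨by simp, by simp, fun a => by simpa using (D.cap_pos a).le⟩

/-- A packing of maximum value, and a dual solution of the same value. -/
lemma exists_packing_dual [DecidableEq A] [Fintype A] (hP : ∀ p ∈ P, p ≠ [] ∧ p.Nodup) (θ : ℝ) :
    ∃ w ∈ D.packings P, ∃ z : A → ℝ, (∀ a, 0 ≤ z a) ∧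
      ∑ a, D.cap a * z a ≤ ∑ p ∈ P, w p * D.sendTime θ p ∧
      ∀ p ∈ P, D.sendTime θ p ≤ (p.map z).sum := by
  classical
  obtain ⟨w, hw, hmax⟩ := (isCompact_packings (D := D) fun p hp => (hP p hp).1).exists_isMaxOn
    ⟨0, zero_mem_packings⟩ (f := fun w => ∑ p ∈ P, w p * D.sendTime θ p)
    (Continuous.continuousOn (by fun_prop))
  obtain ⟨z, hz, hzv, hzp⟩ := exists_dual_of_packing_le P
    (fun p a => if a ∈ p then (1 : ℝ) else 0) D.cap_pos (D.sendTime θ)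
    (∑ p ∈ P, w p * D.sendTime θ p) (fun w' h0 h1 => by
      have hmem : (fun p => if p ∈ P then w' p else 0) ∈ D.packings P := by
        refine ⟨fun p => ?_, fun p hp => if_neg hp, fun a => ?_⟩
        · dsimp only
          split_ifs
          exacts [h0 p, le_rfl]
        · refine le_trans (le_of_eq (Finset.sum_congr rfl fun p hp => ?_)) (h1 a)
          simp [hp]
      refine le_trans (le_of_eq (Finset.sum_congr rfl fun p hp => ?_)) (hmax hmem)
      simp [hp])
  refine ⟨w, hw, z, hz, hzv, fun p hp => (hzp p hp).trans (le_of_eq ?_)⟩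
  rw [← sum_ite_mem_eq (hP p hp).2]
  exact Finset.sum_congr rfl fun a _ => by split_ifs <;> simp

/-- Along a single path, any amount of flow can be sent if there is enough time. -/
lemma exists_packing_singleton [DecidableEq A] {s t : V} (hst : s ≠ t) {p : List A}
    (hp : p ∈ P) (hpath : D.IsPath s p t) {b : ℝ} (hb : 0 < b) :
    ∃ θ, 0 ≤ θ ∧ ∃ w ∈ D.packings P, b ≤ ∑ p ∈ P, w p * D.sendTime θ p := by
  have hne : p ≠ [] := by
    rintro rfl
    exact hst hpath.1
  obtain ⟨e, he, hmin⟩ := exists_min_on_list (x := D.cap) hne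
  have hcap := D.cap_pos e
  have h0 : 0 ≤ (p.map D.transit).sum :=
    List.sum_nonneg (by simpa using fun a _ => D.transit_nonneg a)
  -- At the bottleneck rate `D.cap e`, sending `b` takes time `b / D.cap e`, and the last particle
  -- still has to traverse the path.
  refine ⟨(p.map D.transit).sum + b / D.cap e, by positivity,
    fun q => if q = p then D.cap e else 0, ⟨fun q => ?_, fun q hq => ?_, fun a => ?_⟩, ?_⟩
  · dsimp only
    split_ifs
    exacts [hcap.le, le_rfl]
  · refine if_neg ?_
    rintro rfl
    exact hq hp
  · simp only [ite_mul, zero_mul, Finset.sum_ite_eq', hp, if_true]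
    split_ifs with ha
    · simpa using hmin a ha
    · simpa using (D.cap_pos a).le
  · simp only [ite_mul, zero_mul, Finset.sum_ite_eq', hp, if_true, sendTime, add_sub_cancel_left]
    rw [max_eq_right (by positivity), mul_div_cancel₀ _ hcap.ne']

end Packings

/-! ### Upper bounds on flows over time by cuts. -/

section Flows

variable [Fintype A] [DecidableEq V] {D : Network V A} {storage : Bool} {s t : V} {b θ : ℝ}
  {f : A → ℝ → ℝ}

lemma IsFlow.integrable (hf : D.IsFlow storage s t b θ f) (a : A) : Integrable (f a) := by
  have h : IntegrableOn (f a) (Set.Ico 0 (θ - D.transit a)) := by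
    refine Measure.integrableOn_of_bounded (M := D.cap a) measure_Ico_lt_top.ne
      (hf.measurable a).aestronglyMeasurable (ae_of_all _ fun x => ?_)
    rw [Real.norm_of_nonneg (hf.nonneg a x)]
    exact hf.le_cap a x
  rw [← integrable_indicator_iff measurableSet_Ico] at h
  rwa [show (Set.Ico 0 (θ - D.transit a)).indicator (f a) = f a from funext fun x => ?_] at h
  by_cases hx : x ∈ Set.Ico 0 (θ - D.transit a)
  · simp [hx]
  · rw [Set.indicator_of_notMem hx, hf.eq_zero a x hx]

lemma IsFlow.amount_nonneg (hf : D.IsFlow storage s t b θ f) (a : A) : 0 ≤ D.amount θ f a :=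
  integral_nonneg fun x => hf.nonneg a x

lemma IsFlow.amount_eq_integral (hf : D.IsFlow storage s t b θ f) (a : A) :
    D.amount θ f a = ∫ y, f a y :=
  setIntegral_eq_integral_of_forall_compl_eq_zero fun x hx => hf.eq_zero a x hx

lemma IsFlow.integral_Ico (hf : D.IsFlow storage s t b θ f) (a : A) :
    ∫ y in Set.Ico 0 θ, f a y = D.amount θ f a := by
  rw [hf.amount_eq_integral]
  refine setIntegral_eq_integral_of_forall_compl_eq_zero fun x hx => hf.eq_zero a x ?_
  exact fun h => hx ⟨h.1, h.2.trans_le (by linarith [D.transit_nonneg a])⟩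

lemma IsFlow.amount_eq_zero_iff (hf : D.IsFlow storage s t b θ f) (a : A) :
    D.amount θ f a = 0 ↔ f a =ᵐ[volume] 0 := by
  rw [hf.amount_eq_integral, integral_eq_zero_iff_of_nonneg (fun x => hf.nonneg a x)
    (hf.integrable a)]

lemma IsFlow.pos_horizon (hf : D.IsFlow storage s t b θ f) (hb : 0 < b) : 0 < θ := by
  by_contra! h
  have h1 := hf.demand
  have h2 : ∀ a, Set.Ico 0 (θ - D.transit a) = ∅ := fun a =>
    Set.Ico_eq_empty (not_lt.2 (by linarith [D.transit_nonneg a]))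
  simp only [excess, h2, Set.Ico_eq_empty (not_lt.2 h)] at h1
  simp at h1
  exact hb.ne h1

lemma sum_fiberwise_apply [Fintype V] (g : A → V) (F : A → V → ℝ) :
    ∑ v, ∑ a with g a = v, F a v = ∑ a, F a (g a) := by
  rw [← Finset.sum_fiberwise Finset.univ g]
  refine Finset.sum_congr rfl fun v _ => Finset.sum_congr rfl fun a ha => ?_
  rw [(Finset.mem_filter.1 ha).2]

/-- The final excesses, weighted by `φ` and regrouped by arcs, show that the arc amounts form a
static flow of value `b`. -/
lemma IsFlow.sum_amount_mul (hV : Finite V) (hst : s ≠ t) (hf : D.IsFlow storage s t b θ f)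
    (φ : V → ℝ) :
    ∑ a, D.amount θ f a * (φ (D.head a) - φ (D.tail a)) = b * (φ t - φ s) := by
  have := Fintype.ofFinite V
  have h1 : ∀ v, D.excess f v θ * φ v =
      (∑ a with D.head a = v, D.amount θ f a * φ v) -
        ∑ a with D.tail a = v, D.amount θ f a * φ v := by
    intro v
    simp only [excess, hf.integral_Ico, sub_mul, Finset.sum_mul]
    rfl
  have h2 : ∑ v, D.excess f v θ * φ v = b * (φ t - φ s) := by
    have h3 : ∀ v, D.excess f v θ * φ v =
        (if v = t then b * φ t else 0) - if v = s then b * φ s else 0 := by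
      intro v
      by_cases hs : v = s
      · subst hs
        simp [hst, hf.supply]
      · by_cases ht : v = t
        · subst ht
          simp [hs, hf.demand]
        · simp [hs, ht, hf.no_surplus v hs ht]
    simp only [h3, Finset.sum_sub_distrib, Finset.sum_ite_eq', Finset.mem_univ, if_true]
    ring
  rw [← h2]
  simp only [h1, Finset.sum_sub_distrib, sum_fiberwise_apply, mul_sub]

lemma IsFlow.setIntegral_Ico_sub_le (hf : D.IsFlow storage s t b θ f) (a : A) {x y z : ℝ}
    (hy : 0 ≤ y) (hz : 0 ≤ z) (h : x - y ≤ z) :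
    (∫ r in Set.Ico 0 x, f a r) - ∫ r in Set.Ico 0 y, f a r ≤ D.cap a * z := by
  have hu := (D.cap_pos a).le
  rcases le_total x y with hxy | hxy
  · have : ∫ r in Set.Ico 0 x, f a r ≤ ∫ r in Set.Ico 0 y, f a r :=
      setIntegral_mono_set (hf.integrable a).integrableOn (ae_of_all _ (hf.nonneg a))
        (Set.Ico_subset_Ico_right hxy).eventuallyLE
    have := mul_nonneg hu hz
    linarith
  · rw [← Set.Ico_union_Ico_eq_Ico hy hxy, setIntegral_union (Set.Ico_disjoint_Ico_same)
      measurableSet_Ico (hf.integrable a).integrableOn (hf.integrable a).integrableOn]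
    have h1 : ‖∫ r in Set.Ico y x, f a r‖ ≤ D.cap a * volume.real (Set.Ico y x) :=
      norm_setIntegral_le_of_norm_le_const measure_Ico_lt_top fun r _ => by
        rw [Real.norm_of_nonneg (hf.nonneg a r)]
        exact hf.le_cap a r
    rw [Real.volume_real_Ico_of_le hxy] at h1
    have h2 := (le_abs_self _).trans h1
    have := mul_le_mul_of_nonneg_left h hu
    linarith

/-- The flow value is at most the capacity of a cut over time. -/
lemma IsFlow.le_cut (hV : Finite V) (hf : D.IsFlow storage s t b θ f) (hst : s ≠ t) {T : Set A}
    (hT : ∀ a, a ∉ T → f a =ᵐ[volume] 0) {π : V → ℝ} (h0 : ∀ v, 0 ≤ π v) (hθ : ∀ v, π v ≤ θ)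
    (hs : π s = 0) (ht : π t = θ) {z : A → ℝ} (hz : ∀ a, 0 ≤ z a)
    (hπ : ∀ a ∈ T, π (D.head a) - D.transit a - π (D.tail a) ≤ z a) :
    b ≤ ∑ a, D.cap a * z a := by
  have := Fintype.ofFinite V
  -- Each node is inspected at its own time `π v`. For `s` this is time `0`, when nothing has left
  -- or arrived, so its possible deficit does no harm.
  have h1 : ∀ v ∈ Finset.univ, 0 ≤ D.excess f v (π v) := by
    intro v _
    by_cases hv : v = s
    · subst hv
      simp [hs, excess, D.transit_nonneg]
    · exact hf.no_deficit v hv _ ⟨h0 v, hθ v⟩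
  calc b = D.excess f t (π t) := by rw [ht, hf.demand]
    _ ≤ ∑ v, D.excess f v (π v) := Finset.single_le_sum h1 (Finset.mem_univ t)
    _ = ∑ a, ((∫ y in Set.Ico 0 (π (D.head a) - D.transit a), f a y) -
          ∫ y in Set.Ico 0 (π (D.tail a)), f a y) := by
        simp only [excess, Finset.sum_sub_distrib]
        rw [sum_fiberwise_apply D.head fun a v => ∫ y in Set.Ico 0 (π v - D.transit a), f a y,
          sum_fiberwise_apply D.tail fun a v => ∫ y in Set.Ico 0 (π v), f a y]
    _ ≤ ∑ a, D.cap a * z a := by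
        refine Finset.sum_le_sum fun a _ => ?_
        by_cases ha : a ∈ T
        · exact hf.setIntegral_Ico_sub_le a (h0 _) (hz a) (hπ a ha)
        · have h3 : ∀ S : Set ℝ, ∫ y in S, f a y = 0 := fun S => by
            rw [integral_congr_ae (ae_restrict_of_ae (hT a ha))]
            simp
          rw [h3, h3, sub_zero]
          exact mul_nonneg (D.cap_pos a).le (hz a)

/-- The value of a flow over time in the arc set `T` is bounded by the value of a temporally
repeated flow along paths in `T`. -/
lemma IsFlow.exists_packing [DecidableEq A] (hV : Finite V) (hf : D.IsFlow storage s t b θ f)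
    (hb : 0 < b) (hst : s ≠ t) {T : Set A} (hT : ∀ a, a ∉ T → f a =ᵐ[volume] 0)
    {P : Finset (List A)} (hP : ∀ p, p ∈ P ↔ D.IsPath s p t ∧ ∀ a ∈ p, a ∈ T) :
    ∃ w ∈ D.packings P, b ≤ ∑ p ∈ P, w p * D.sendTime θ p := by
  classical
  have hne : ∀ p, D.IsPath s p t → p ≠ [] := by
    rintro _ hp rfl
    exact hst hp.1
  obtain ⟨w, hw, z, hz, hzv, hzp⟩ := exists_packing_dual (D := D)
    (fun p hp => ⟨hne p ((hP p).1 hp).1, ((hP p).1 hp).1.nodup⟩) θ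
  refine ⟨w, hw, le_trans ?_ hzv⟩
  have hθ := (hf.pos_horizon hb).le
  -- With these lengths, and start penalty `θ` away from `s`, the node `t` has distance exactly `θ`:
  -- an s-t-path in `T` has length at least `θ` by dual feasibility, and any other s-t-path contains
  -- an arc of length `θ`.
  let c : A → ℝ := fun a => if a ∈ T then D.transit a + z a else θ
  have hc : ∀ a, 0 ≤ c a := fun a => by
    simp only [c]
    split_ifs
    exacts [add_nonneg (D.transit_nonneg a) (hz a), hθ]
  have hcs : ∀ p : List A, 0 ≤ (p.map c).sum := fun p =>
    List.sum_nonneg (by simpa using fun a _ => hc a)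
  obtain ⟨π, h1, h2, h3⟩ := exists_potential (D := D) (c := c) (fun p _ => hcs p)
    (fun v => if v = s then 0 else θ)
  have h0 : ∀ v, 0 ≤ π v := by
    intro v
    obtain ⟨u, p, -, hπ⟩ := h3 v
    rw [hπ]
    refine add_nonneg ?_ (hcs p)
    split_ifs
    exacts [le_rfl, hθ]
  refine hf.le_cut hV hst hT h0 (fun v => (h2 v).trans ?_)
    (le_antisymm (by simpa using h2 s) (h0 s)) (le_antisymm ((h2 t).trans ?_) ?_) hz ?_
  · split_ifs
    exacts [hθ, le_rfl]
  · simp [hst.symm]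
  · obtain ⟨u, p, hp, hπ⟩ := h3 t
    rw [hπ]
    split_ifs with hu
    · subst hu
      rw [zero_add]
      by_cases hpT : ∀ a ∈ p, a ∈ T
      · have h4 := hzp p ((hP p).2 ⟨hp, hpT⟩)
        have h5 : (p.map c).sum = (p.map D.transit).sum + (p.map z).sum := by
          rw [← List.sum_map_add]
          exact congrArg List.sum (List.map_congr_left fun a ha => if_pos (hpT a ha))
        have h6 : θ - (p.map D.transit).sum ≤ D.sendTime θ p := le_max_right _ _
        linarith
      · push Not at hpT
        obtain ⟨a, ha, haT⟩ := hpT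
        have := List.single_le_sum (l := p.map c) (by simpa using fun a _ => hc a) (c a)
          (List.mem_map_of_mem ha)
        simpa [c, haT] using this
    · linarith [hcs p]
  · intro a ha
    have := h1 a
    simp only [c, if_pos ha] at this
    linarith

end Flows

end Network

/-! ### Temporally repeated flows. -/

namespace Network

variable {V A : Type*}

/-- Flow at unit rate along a list of arcs, entering the first arc during `[σ, σ + L)`. -/
noncomputable def pathRate [DecidableEq A] (D : Network V A) (L : ℝ) :
    List A → ℝ → A → ℝ → ℝ
  | [], _, _, _ => 0
  | e :: p, σ, a, x => (if a = e then (Set.Ico σ (σ + L)).indicator 1 x else 0) +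
      D.pathRate L p (σ + D.transit e) a x

section Excess

variable {D : Network V A} [Fintype A] [DecidableEq V]

lemma excess_add {f g : A → ℝ → ℝ} (hf : ∀ a, Integrable (f a)) (hg : ∀ a, Integrable (g a))
    (v : V) (x : ℝ) :
    D.excess (fun a y => f a y + g a y) v x = D.excess f v x + D.excess g v x := by
  simp only [excess, integral_add (hf _).integrableOn (hg _).integrableOn,
    Finset.sum_add_distrib]
  ring

lemma excess_sum {ι : Type*} (P : Finset ι) (w : ι → ℝ) {f : ι → A → ℝ → ℝ}
    (hf : ∀ p a, Integrable (f p a)) (v : V) (x : ℝ) :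
    D.excess (fun a y => ∑ p ∈ P, w p * f p a y) v x = ∑ p ∈ P, w p * D.excess (f p) v x := by
  have h : ∀ (a : A) (S : Set ℝ), ∫ y in S, ∑ p ∈ P, w p * f p a y =
      ∑ p ∈ P, w p * ∫ y in S, f p a y := by
    intro a S
    rw [integral_finsetSum _ fun p _ => ((hf p a).const_mul (w p)).integrableOn]
    simp only [integral_const_mul]
  simp only [excess, h, mul_sub, Finset.sum_sub_distrib, Finset.mul_sum]
  rw [Finset.sum_comm, Finset.sum_comm (s := Finset.univ.filter fun a => D.tail a = v)]

end Excess

section PathRate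

variable [DecidableEq A] {D : Network V A} {L : ℝ}

lemma pathRate_nonneg (p : List A) (σ : ℝ) (a : A) (x : ℝ) : 0 ≤ D.pathRate L p σ a x := by
  induction p generalizing σ with
  | nil => exact le_rfl
  | cons e p ih =>
    refine add_nonneg ?_ (ih _)
    split_ifs
    · exact Set.indicator_nonneg (by simp) _
    · exact le_rfl

lemma pathRate_of_notMem {p : List A} {a : A} (ha : a ∉ p) (σ x : ℝ) :
    D.pathRate L p σ a x = 0 := by
  induction p generalizing σ with
  | nil => rfl
  | cons e p ih =>
    rw [List.mem_cons, not_or] at ha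
    simp [pathRate, ha.1, ih ha.2]

lemma pathRate_le {p : List A} (hp : p.Nodup) (σ : ℝ) (a : A) (x : ℝ) :
    D.pathRate L p σ a x ≤ if a ∈ p then 1 else 0 := by
  induction p generalizing σ with
  | nil => simp [pathRate]
  | cons e p ih =>
    rw [List.nodup_cons] at hp
    rw [pathRate]
    by_cases ha : a = e
    · subst ha
      rw [pathRate_of_notMem hp.1]
      have : (Set.Ico σ (σ + L)).indicator (1 : ℝ → ℝ) x ≤ 1 :=
        Set.indicator_apply_le' (fun _ => le_rfl) fun _ => zero_le_one
      simpa using this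
    · have := ih hp.2 (σ + D.transit e)
      simpa [ha] using this

/-- This makes temporally repeated flows respect the horizon. The claim `0 < L` shows that the
maximum in `sendTime` is not its default `0`. -/
lemma pathRate_ne_zero {p : List A} {σ : ℝ} {a : A} {x : ℝ} (h : D.pathRate L p σ a x ≠ 0) :
    0 < L ∧ σ ≤ x ∧ x + D.transit a < σ + L + (p.map D.transit).sum := by
  induction p generalizing σ with
  | nil => exact absurd rfl h
  | cons e p ih =>
    have he := D.transit_nonneg e
    rw [List.map_cons, List.sum_cons]
    by_cases h2 : D.pathRate L p (σ + D.transit e) a x = 0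
    · rw [pathRate, h2, add_zero] at h
      split_ifs at h with ha
      · subst ha
        have hx := Set.mem_of_indicator_ne_zero h
        have : 0 ≤ (p.map D.transit).sum :=
          List.sum_nonneg (by simpa using fun a _ => D.transit_nonneg a)
        exact ⟨by linarith [hx.1, hx.2], hx.1, by linarith [hx.2]⟩
      · exact absurd rfl h
    · obtain ⟨h3, h4, h5⟩ := ih h2
      exact ⟨h3, by linarith, by linarith⟩

lemma integrable_pathRate (p : List A) (σ : ℝ) (a : A) : Integrable (D.pathRate L p σ a) := by
  induction p generalizing σ with
  | nil => exact integrable_zero _ _ _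
  | cons e p ih =>
    refine Integrable.add ?_ (ih _)
    split_ifs
    · rw [integrable_indicator_iff measurableSet_Ico]
      exact integrableOn_const measure_Ico_lt_top.ne
    · exact integrable_zero _ _ _

/-- The amount of flow that has been sent by time `x` at unit rate during `[σ, σ + L)`. -/
noncomputable def sent (L σ x : ℝ) : ℝ := max (min x (σ + L) - σ) 0

lemma integral_indicator_eq_sent {σ : ℝ} (hσ : 0 ≤ σ) (x : ℝ) :
    ∫ y in Set.Ico 0 x, (Set.Ico σ (σ + L)).indicator (1 : ℝ → ℝ) y = sent L σ x := by
  rw [setIntegral_indicator measurableSet_Ico, Set.Ico_inter_Ico]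
  simp [sent, hσ]

variable [Fintype A] [DecidableEq V]

lemma excess_single (e : A) (g : ℝ → ℝ) (v : V) (x : ℝ) :
    D.excess (fun a y => if a = e then g y else 0) v x =
      (if D.head e = v then ∫ y in Set.Ico 0 (x - D.transit e), g y else 0) -
        if D.tail e = v then ∫ y in Set.Ico 0 x, g y else 0 := by
  have h : ∀ (a : A) (S : Set ℝ), ∫ y in S, (if a = e then g y else 0) =
      if a = e then ∫ y in S, g y else 0 := by
    intro a S
    split_ifs <;> simp
  simp only [excess, h, Finset.sum_ite_eq', Finset.mem_filter, Finset.mem_univ, true_and]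

/-- Flow leaving one arc enters the next at the same moment, so the contributions telescope and
nothing is ever stored on the way. -/
lemma excess_pathRate {p : List A} {v w : V} (hp : D.IsWalk v p w) {σ : ℝ} (hσ : 0 ≤ σ)
    (u : V) (x : ℝ) :
    D.excess (D.pathRate L p σ) u x =
      (if w = u then sent L (σ + (p.map D.transit).sum) x else 0) -
        if v = u then sent L σ x else 0 := by
  induction p generalizing v σ with
  | nil =>
    have : v = w := hp
    subst this
    have : D.pathRate L [] σ = fun _ _ => 0 := rfl
    simp [this, excess]
  | cons e p ih =>
    obtain ⟨rfl, hp⟩ := hp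
    have he := D.transit_nonneg e
    have h1 : D.pathRate L (e :: p) σ = fun a y =>
        (fun a y => if a = e then (Set.Ico σ (σ + L)).indicator (1 : ℝ → ℝ) y else 0) a y +
          D.pathRate L p (σ + D.transit e) a y := rfl
    rw [h1, excess_add _ (integrable_pathRate _ _), excess_single, ih hp (add_nonneg hσ he),
      integral_indicator_eq_sent hσ, integral_indicator_eq_sent hσ, List.map_cons, List.sum_cons,
      ← add_assoc]
    · have h2 : sent L σ (x - D.transit e) = sent L (σ + D.transit e) x := by
        unfold sent
        rw [show σ + D.transit e + L = σ + L + D.transit e by ring,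
          show x = x - D.transit e + D.transit e by ring, min_add_add_right]
        simp
      rw [h2]
      split_ifs <;> ring
    · intro a
      split_ifs
      · rw [integrable_indicator_iff measurableSet_Ico]
        exact integrableOn_const measure_Ico_lt_top.ne
      · exact integrable_zero _ _ _

/-- Temporally repeated flows. -/
lemma exists_isFlow_of_packing {s t : V} (hst : s ≠ t) {P : Finset (List A)}
    (hP : ∀ p ∈ P, D.IsPath s p t) {b θ : ℝ} (hb : 0 < b) (hθ : 0 ≤ θ) {w : List A → ℝ}
    (hw : w ∈ D.packings P) (hbw : b ≤ ∑ p ∈ P, w p * D.sendTime θ p) (storage : Bool) :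
    ∃ f, D.IsFlow storage s t b θ f ∧ ∀ a, (∀ p ∈ P, a ∉ p) → f a = 0 := by
  set B := ∑ p ∈ P, w p * D.sendTime θ p with hB
  have hB0 : 0 < B := hb.trans_le hbw
  -- Scaling down makes the value exactly `b` and keeps the capacities respected.
  let w' : List A → ℝ := fun p => b / B * w p
  have hw0 : ∀ p, 0 ≤ w' p := fun p => mul_nonneg (div_nonneg hb.le hB0.le) (hw.1 p)
  have hww : ∀ p, w' p ≤ w p := fun p =>
    mul_le_of_le_one_left (hw.1 p) ((div_le_one hB0).2 hbw)
  have hsum : ∑ p ∈ P, w' p * D.sendTime θ p = b := by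
    simp only [w', mul_assoc]
    rw [← Finset.mul_sum, ← hB, div_mul_cancel₀ _ hB0.ne']
  let f : A → ℝ → ℝ := fun a x => ∑ p ∈ P, w' p * D.pathRate (D.sendTime θ p) p 0 a x
  have hex : ∀ v x, D.excess f v x = ∑ p ∈ P, w' p *
      ((if t = v then sent (D.sendTime θ p) (p.map D.transit).sum x else 0) -
        if s = v then sent (D.sendTime θ p) 0 x else 0) := by
    intro v x
    rw [excess_sum P w' fun p a => integrable_pathRate p 0 a]
    refine Finset.sum_congr rfl fun p hp => ?_
    rw [excess_pathRate (hP p hp).1 le_rfl, zero_add]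
  have hinner : ∀ v, v ≠ s → v ≠ t → ∀ x, D.excess f v x = 0 := by
    intro v hs ht x
    simp [hex, hs.symm, ht.symm]
  refine ⟨f, ⟨fun a => ?_, fun a x => ?_, fun a x => ?_, fun a x hx => ?_, fun v hv x _ => ?_,
    fun v hs ht => hinner v hs ht θ, fun _ v hs ht x _ => hinner v hs ht x, ?_, ?_⟩,
    fun a ha => ?_⟩
  · exact (integrable_finsetSum P fun p _ =>
      (integrable_pathRate p 0 a).const_mul (w' p)).aestronglyMeasurable.aemeasurable
  · exact Finset.sum_nonneg fun p _ => mul_nonneg (hw0 p) (pathRate_nonneg _ _ _ _)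
  · refine le_trans (Finset.sum_le_sum fun p hp => ?_) (hw.2.2 a)
    exact mul_le_mul (hww p) (pathRate_le (hP p hp).nodup _ _ _) (pathRate_nonneg _ _ _ _)
      (hw.1 p)
  · refine Finset.sum_eq_zero fun p _ => ?_
    by_contra hne
    obtain ⟨h1, h2, h3⟩ := pathRate_ne_zero (right_ne_zero_of_mul hne)
    refine hx ⟨h2, ?_⟩
    have h4 : D.sendTime θ p = θ - (p.map D.transit).sum :=
      (max_choice _ _).resolve_left h1.ne'
    rw [h4] at h3
    linarith
  · rw [hex]
    refine Finset.sum_nonneg fun p _ => mul_nonneg (hw0 p) ?_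
    rw [if_neg hv.symm, sub_zero]
    split_ifs
    exacts [le_max_right _ _, le_rfl]
  · rw [hex, ← hsum, ← Finset.sum_neg_distrib]
    refine Finset.sum_congr rfl fun p _ => ?_
    have h0 : 0 ≤ (p.map D.transit).sum :=
      List.sum_nonneg (by simpa using fun a _ => D.transit_nonneg a)
    have h1 : D.sendTime θ p ≤ θ := max_le hθ (by linarith)
    have h2 : 0 ≤ D.sendTime θ p := sendTime_nonneg _ _
    simp [hst.symm, sent, h1, h2]
  · rw [hex, ← hsum]
    refine Finset.sum_congr rfl fun p _ => ?_
    have h1 : sent (D.sendTime θ p) (p.map D.transit).sum θ = D.sendTime θ p := by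
      have h2 : θ ≤ (p.map D.transit).sum + D.sendTime θ p := by
        have : θ - (p.map D.transit).sum ≤ D.sendTime θ p := le_max_right _ _
        linarith
      rw [sent, min_eq_left h2, max_comm]
      rfl
    simp [hst, h1]
  · ext x
    exact Finset.sum_eq_zero fun p hp => by rw [pathRate_of_notMem (ha p hp), mul_zero]

end PathRate

/-! ### Passing between a network and its subnetworks. -/

section Restrict

lemma extendByZero_coe {B : Finset A} (g : B → ℝ → ℝ) (a : B) : extendByZero g (a : A) = g a := by
  simp [extendByZero]

lemma extendByZero_of_notMem {B : Finset A} (g : B → ℝ → ℝ) {a : A} (ha : a ∉ B) :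
    extendByZero g a = 0 := by
  simp [extendByZero, ha]

variable [Fintype A] [DecidableEq V] {D : Network V A} {storage : Bool} {s t : V} {b θ : ℝ}

lemma excess_restrict {B : Finset A} {f : A → ℝ → ℝ} (h : ∀ a, a ∉ B → f a =ᵐ[volume] 0)
    (v : V) (x : ℝ) : (D.restrict B).excess (fun a : B => f a) v x = D.excess f v x := by
  have h0 : ∀ a, a ∉ B → ∀ S : Set ℝ, ∫ y in S, f a y = 0 := fun a ha S => by
    rw [integral_congr_ae (ae_restrict_of_ae (h a ha))]
    simp
  have key : ∀ (n : A → V) (F : A → ℝ), (∀ a, a ∉ B → F a = 0) →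
      ∑ a ∈ Finset.univ.filter (fun a : B => n a = v), F a =
        ∑ a ∈ Finset.univ.filter (fun a : A => n a = v), F a := by
    intro n F hF
    rw [Finset.sum_filter, Finset.sum_filter,
      Finset.sum_coe_sort B fun a => if n a = v then F a else 0]
    exact Finset.sum_subset (Finset.subset_univ _) fun a _ ha => by simp [hF a ha]
  exact congrArg₂ (· - ·)
    (key D.head (fun a => ∫ y in Set.Ico 0 (x - D.transit a), f a y) fun a ha => h0 a ha _)
    (key D.tail (fun a => ∫ y in Set.Ico 0 x, f a y) fun a ha => h0 a ha _)

lemma IsFlow.restrict {B : Finset A} {f : A → ℝ → ℝ} (hf : D.IsFlow storage s t b θ f)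
    (h : ∀ a, a ∉ B → f a =ᵐ[volume] 0) :
    (D.restrict B).IsFlow storage s t b θ fun a : B => f a where
  measurable a := hf.measurable a
  nonneg a := hf.nonneg a
  le_cap a := hf.le_cap a
  eq_zero a := hf.eq_zero a
  no_deficit v hv x hx := by
    rw [excess_restrict h]
    exact hf.no_deficit v hv x hx
  no_surplus v hs ht := by
    rw [excess_restrict h]
    exact hf.no_surplus v hs ht
  no_storage hsto v hs ht x hx := by
    rw [excess_restrict h]
    exact hf.no_storage hsto v hs ht x hx
  supply := by
    rw [excess_restrict h]
    exact hf.supply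
  demand := by
    rw [excess_restrict h]
    exact hf.demand

lemma IsFlow.extendByZero {B : Finset A} {g : B → ℝ → ℝ}
    (hg : (D.restrict B).IsFlow storage s t b θ g) :
    D.IsFlow storage s t b θ (Network.extendByZero g) := by
  have hex : ∀ v x, D.excess (Network.extendByZero g) v x = (D.restrict B).excess g v x := by
    intro v x
    rw [← excess_restrict (B := B) fun a ha => by rw [extendByZero_of_notMem g ha]]
    simp only [extendByZero_coe]
  have hval : ∀ {p : A → (ℝ → ℝ) → Prop}, (∀ a : B, p a (g a)) → (∀ a, p a 0) →
      ∀ a, p a (Network.extendByZero g a) := by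
    intro p h1 h2 a
    by_cases ha : a ∈ B
    · have := extendByZero_coe g ⟨a, ha⟩
      dsimp only at this
      rw [this]
      exact h1 ⟨a, ha⟩
    · rw [extendByZero_of_notMem g ha]
      exact h2 a
  exact {
    measurable := hval (p := fun _ h => AEMeasurable h volume) hg.measurable
      fun _ => aemeasurable_const
    nonneg := hval (p := fun _ h => ∀ x, 0 ≤ h x) hg.nonneg fun _ _ => le_rfl
    le_cap := hval (p := fun a h => ∀ x, h x ≤ D.cap a) hg.le_cap fun a _ => (D.cap_pos a).le
    eq_zero := hval (p := fun a h => ∀ x, x ∉ Set.Ico 0 (θ - D.transit a) → h x = 0) hg.eq_zero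
      fun _ _ _ => rfl
    no_deficit := by simpa only [hex] using hg.no_deficit
    no_surplus := by simpa only [hex] using hg.no_surplus
    no_storage := by simpa only [hex] using hg.no_storage
    supply := by rw [hex, hg.supply]
    demand := by rw [hex, hg.demand] }

end Restrict

end Network

namespace Network

variable {V A : Type*}

/-! ### Minimum cost and quickest flows. -/

section MinCost

variable [Fintype A] {D : Network V A} {s t : V}

/-- There is a set `T` of tight arcs such that the cheapest paths are the paths in `T`, the cycles
of cost zero are the cycles in `T`, and the static flows of minimum cost are those in `T`. -/
lemma exists_tight_arcs [Finite V] (hD : D.Conservative) (h : ∃ p, D.IsPath s p t) :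
    ∃ (T : Set A) (m : ℝ), (∀ p, D.IsCheapestPath s t p ↔ D.IsPath s p t ∧ ∀ a ∈ p, a ∈ T) ∧
      (∀ p, D.IsZeroCycle p ↔ D.IsCycle p ∧ ∀ a ∈ p, a ∈ T) ∧
      ∀ (x : A → ℝ) (b : ℝ), (∀ a, 0 ≤ x a) →
        (∀ φ : V → ℝ, ∑ a, x a * (φ (D.head a) - φ (D.tail a)) = b * (φ t - φ s)) →
        b * m ≤ ∑ a, D.cost a * x a ∧
          (∑ a, D.cost a * x a ≤ b * m ↔ ∀ a, a ∉ T → x a = 0) := by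
  obtain ⟨p₀, hp₀⟩ := exists_isCheapestPath h
  obtain ⟨π, hr, hπ⟩ := exists_tight_potential hD hp₀
  set r : A → ℝ := fun a => D.cost a - (π (D.head a) - π (D.tail a)) with hrdef
  have hr0 : ∀ a, 0 ≤ r a := hr
  have hcost : ∀ {p v w}, D.IsWalk v p w → D.listCost p = (p.map r).sum + (π w - π v) := by
    intro p v w hp
    rw [← hp.sum_sub π, ← List.sum_map_add]
    simp [listCost, hrdef]
  have hrs : ∀ p : List A, 0 ≤ (p.map r).sum := fun p =>
    List.sum_nonneg (by simpa using fun a _ => hr0 a)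
  have hrz : ∀ p : List A, (p.map r).sum ≤ 0 ↔ ∀ a ∈ p, r a = 0 := by
    intro p
    constructor
    · intro h a ha
      exact le_antisymm ((List.single_le_sum (l := p.map r) (by simpa using fun a _ => hr0 a) _
        (List.mem_map_of_mem ha)).trans h) (hr0 a)
    · intro h
      exact (List.sum_eq_zero (by simpa using h)).le
  refine ⟨{a | r a = 0}, π t - π s, fun p => ⟨fun hp => ⟨hp.1, ?_⟩, fun hp => ⟨hp.1, ?_⟩⟩,
    fun p => ⟨fun hp => ⟨hp.1, ?_⟩, fun hp => ⟨hp.1, ?_⟩⟩, fun x b hx hcons => ?_⟩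
  · refine (hrz p).1 ?_
    have h1 := hp.2 p₀ hp₀.1
    rw [hcost hp.1.1] at h1
    linarith
  · intro q hq
    have h1 := (hrz p).2 hp.2
    have h2 := hrs q
    rw [hcost hp.1.1, hcost hq.1]
    linarith
  · obtain ⟨v, hv⟩ := hp.1.2.1
    refine (hrz p).1 ?_
    have h1 := hcost hv
    rw [hp.2] at h1
    linarith
  · obtain ⟨v, hv⟩ := hp.1.2.1
    rw [hcost hv, le_antisymm ((hrz p).2 hp.2) (hrs p)]
    ring
  -- Conservation tested against `π` itself splits off the constant part; the rest is a sum of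
  -- nonnegative terms.
  · have h1 : ∑ a, D.cost a * x a = ∑ a, r a * x a + b * (π t - π s) := by
      rw [← hcons, ← Finset.sum_add_distrib]
      exact Finset.sum_congr rfl fun a _ => by simp only [hrdef]; ring
    have h2 : ∀ a ∈ Finset.univ, 0 ≤ r a * x a := fun a _ => mul_nonneg (hr0 a) (hx a)
    have h3 := Finset.sum_nonneg h2
    refine ⟨by linarith, ?_⟩
    rw [h1, add_le_iff_nonpos_left, h3.ge_iff_eq', Finset.sum_eq_zero_iff_of_nonneg h2]
    simp only [Finset.mem_univ, true_implies, mul_eq_zero, Set.mem_ofPred_eq]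
    exact forall_congr' fun a => or_iff_not_imp_left

lemma mem_cheapestArcs {a : A} :
    a ∈ D.cheapestArcs s t ↔ ∃ p, D.IsCheapestPath s t p ∧ a ∈ p := by
  simp [cheapestArcs]

variable [DecidableEq V] {storage : Bool} {b θ : ℝ} {f : A → ℝ → ℝ}

lemma IsFlow.exists_isPath [Finite V] (hf : D.IsFlow storage s t b θ f) (hst : s ≠ t)
    (hb : 0 < b) : ∃ p, D.IsPath s p t := by
  obtain ⟨p, hp, -⟩ := exists_isPath_of_sum_eq hf.amount_nonneg
    (hf.sum_amount_mul inferInstance hst) hb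
  exact ⟨p, hp⟩

/-- Flow can be sent along cheapest paths only. -/
lemma exists_isFlow_cheapest [Finite V] (hst : s ≠ t) (hb : 0 < b) (h : ∃ p, D.IsPath s p t)
    (storage : Bool) : ∃ θ f, D.IsFlow storage s t b θ f ∧ ∀ a, a ∉ D.cheapestArcs s t → f a = 0 := by
  classical
  obtain ⟨p, hp⟩ := exists_isCheapestPath h
  obtain ⟨θ, hθ, w, hw, hbw⟩ := exists_packing_singleton hst (Finset.mem_singleton_self p) hp.1 hb
  obtain ⟨f, hf, hf0⟩ := exists_isFlow_of_packing hst (by simpa using hp.1) hb hθ hw hbw storage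
  refine ⟨θ, f, hf, fun a ha => hf0 a fun q hq haq => ha ?_⟩
  rw [Finset.mem_singleton] at hq
  subst hq
  exact mem_cheapestArcs.2 ⟨q, hp, haq⟩

/-- The bound `b * m` is attained by a flow along a single cheapest path with a long enough horizon,
so it is the minimum cost. -/
lemma IsFlow.isMinCostFlow_iff [Finite V] (hf : D.IsFlow storage s t b θ f) (hst : s ≠ t)
    (hb : 0 < b) {T : Set A} {m : ℝ}
    (hT : ∀ p, D.IsCheapestPath s t p ↔ D.IsPath s p t ∧ ∀ a ∈ p, a ∈ T)
    (hm : ∀ (x : A → ℝ) (b : ℝ), (∀ a, 0 ≤ x a) →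
        (∀ φ : V → ℝ, ∑ a, x a * (φ (D.head a) - φ (D.tail a)) = b * (φ t - φ s)) →
        b * m ≤ ∑ a, D.cost a * x a ∧
          (∑ a, D.cost a * x a ≤ b * m ↔ ∀ a, a ∉ T → x a = 0)) :
    D.IsMinCostFlow storage s t b θ f ↔ ∀ a, a ∉ T → f a =ᵐ[volume] 0 := by
  have key : ∀ {θ' g}, D.IsFlow storage s t b θ' g → b * m ≤ D.flowCost θ' g ∧
      (D.flowCost θ' g ≤ b * m ↔ ∀ a, a ∉ T → g a =ᵐ[volume] 0) := by
    intro θ' g hg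
    simp only [← hg.amount_eq_zero_iff]
    exact hm _ b hg.amount_nonneg (hg.sum_amount_mul inferInstance hst)
  rw [← (key hf).2]
  refine ⟨fun h => ?_, fun h => ⟨hf, fun θ' g hg => h.trans (key hg).1⟩⟩
  obtain ⟨θ', g, hg, hg0⟩ := exists_isFlow_cheapest hst hb (hf.exists_isPath hst hb) storage
  refine (h.2 θ' g hg).trans ((key hg).2.2 fun a ha => ?_)
  rw [hg0 a]
  rw [mem_cheapestArcs]
  rintro ⟨p, hp, hap⟩
  exact ha (((hT p).1 hp).2 a hap)

/-- `T` may contain arcs on no cheapest path and no zero cycle; decomposition shows that a flow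
inside `T` does not use them. -/
lemma IsFlow.isMinCostFlow_tfae [Finite V] (hD : D.Conservative) (hst : s ≠ t) (hb : 0 < b)
    (hf : D.IsFlow storage s t b θ f) :
    List.TFAE [
      D.IsMinCostFlow storage s t b θ f,
      SentAlong (D.amount θ f) {p | D.IsCheapestPath s t p ∨ D.IsZeroCycle p},
      ∀ a, a ∉ D.cheapestArcs s t → (¬ ∃ p, D.IsZeroCycle p ∧ a ∈ p) → f a =ᵐ[volume] 0] := by
  obtain ⟨T, m, hT, hT', hm⟩ := exists_tight_arcs hD (hf.exists_isPath hst hb)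
  tfae_have 1 → 2 := by
    intro h
    rw [hf.isMinCostFlow_iff hst hb hT hm] at h
    refine sentAlong_of_static_flow (T := T) hst (fun p hp hpT => Or.inr ((hT' p).2 ⟨hp, hpT⟩))
      (fun p hp hpT => Or.inl ((hT p).2 ⟨hp, hpT⟩)) hf.amount_nonneg (fun a ha => ?_) hb.le
      (hf.sum_amount_mul inferInstance hst)
    by_contra haT
    exact ha.ne' ((hf.amount_eq_zero_iff a).2 (h a haT))
  tfae_have 2 → 3 := by
    rintro ⟨P, w, hP, hx⟩ a ha ha'
    rw [← hf.amount_eq_zero_iff, hx]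
    refine Finset.sum_eq_zero fun p hp => if_neg fun hap => ?_
    rcases (hP p hp).1 with h | h
    · exact ha (mem_cheapestArcs.2 ⟨p, h, hap⟩)
    · exact ha' ⟨p, h, hap⟩
  tfae_have 3 → 1 := by
    intro h
    rw [hf.isMinCostFlow_iff hst hb hT hm]
    intro a haT
    refine h a ?_ ?_
    · rw [mem_cheapestArcs]
      rintro ⟨p, hp, hap⟩
      exact haT (((hT p).1 hp).2 a hap)
    · rintro ⟨p, hp, hap⟩
      exact haT (((hT' p).1 hp).2 a hap)
  tfae_finish

/-- A packing of cheapest paths gives a flow over time in the cheapest-paths network. -/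
lemma exists_isFlow_cheapestPathsNetwork [DecidableEq A] (hst : s ≠ t) (hb : 0 < b) (hθ : 0 ≤ θ)
    {P : Finset (List A)} (hP : ∀ p ∈ P, D.IsCheapestPath s t p) {w : List A → ℝ}
    (hw : w ∈ D.packings P) (hbw : b ≤ ∑ p ∈ P, w p * D.sendTime θ p) (storage : Bool) :
    ∃ g, (D.cheapestPathsNetwork s t).IsFlow storage s t b θ g := by
  obtain ⟨f, hf, hf0⟩ := exists_isFlow_of_packing hst (fun p hp => (hP p hp).1) hb hθ hw hbw storage
  refine ⟨_, hf.restrict fun a ha => ?_⟩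
  rw [hf0 a fun p hp hap => ha (mem_cheapestArcs.2 ⟨p, hP p hp, hap⟩)]

/-- A competing minimum cost flow lives in `T`, hence is matched by a packing of s-t-paths in `T`
with the same horizon. These are cheapest paths, so the repeated flow lies in the cheapest-paths
network. -/
lemma IsQuickestFlow.isQuickestMinCostFlow_extendByZero [Finite V] (hD : D.Conservative)
    (hst : s ≠ t) (hb : 0 < b) {g : D.cheapestArcs s t → ℝ → ℝ}
    (hg : (D.cheapestPathsNetwork s t).IsQuickestFlow storage s t b θ g) :
    D.IsQuickestMinCostFlow storage s t b θ (extendByZero g) := by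
  classical
  have hf : D.IsFlow storage s t b θ (extendByZero g) := hg.1.extendByZero
  obtain ⟨T, m, hT, -, hm⟩ := exists_tight_arcs hD (hf.exists_isPath hst hb)
  refine ⟨((hf.isMinCostFlow_tfae hD hst hb).out 0 2).2
    fun a ha _ => by rw [extendByZero_of_notMem g ha], fun θ' h hh => ?_⟩
  have hP : ∀ p, p ∈ (finite_setOf_isPath (D := D) s t).toFinset.filter (fun p => ∀ a ∈ p, a ∈ T) ↔
      D.IsPath s p t ∧ ∀ a ∈ p, a ∈ T := by simp
  obtain ⟨w, hw, hbw⟩ := hh.1.exists_packing inferInstance hb hst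
    ((hh.1.isMinCostFlow_iff hst hb hT hm).1 hh) hP
  obtain ⟨g', hg'⟩ := exists_isFlow_cheapestPathsNetwork hst hb (hh.1.pos_horizon hb).le
    (fun p hp => (hT p).2 ((hP p).1 hp)) hw hbw storage
  exact hg.2 θ' g' hg'

/-- A horizon is attainable exactly if some packing of cheapest paths has value at least `b` for it.
Such pairs of packing and horizon up to `Θ` form a compact set, on which the horizon has a minimum.
-/
lemma exists_isQuickestFlow_cheapestPathsNetwork [Finite V] (hD : D.Conservative) (hst : s ≠ t)
    (hb : 0 < b) (h : ∃ p, D.IsPath s p t) (storage : Bool) :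
    ∃ θ g, (D.cheapestPathsNetwork s t).IsQuickestFlow storage s t b θ g := by
  classical
  obtain ⟨T, m, hT, -, hm⟩ := exists_tight_arcs hD h
  obtain ⟨p₀, hp₀⟩ := exists_isCheapestPath h
  set P := (finite_setOf_isPath (D := D) s t).toFinset.filter (fun p => ∀ a ∈ p, a ∈ T) with hPdef
  have hP : ∀ p, p ∈ P ↔ D.IsPath s p t ∧ ∀ a ∈ p, a ∈ T := by simp [hPdef]
  have hne : ∀ p ∈ P, p ≠ [] := by
    rintro _ hp rfl
    exact hst ((hP _).1 hp).1.1
  obtain ⟨Θ, hΘ, w₀, hw₀, hbw₀⟩ := exists_packing_singleton hst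
    ((hP p₀).2 ((hT p₀).1 hp₀)) hp₀.1 hb
  let K : Set ((List A → ℝ) × ℝ) := (D.packings P ×ˢ Set.Icc 0 Θ) ∩
    {x | b ≤ ∑ p ∈ P, x.1 p * D.sendTime x.2 p}
  have hK : IsCompact K := by
    refine ((isCompact_packings hne).prod isCompact_Icc).inter_right
      (isClosed_le continuous_const (continuous_finsetSum _ fun p _ => ?_))
    exact ((continuous_apply p).comp continuous_fst).mul
      ((continuous_sendTime p).comp continuous_snd)
  obtain ⟨⟨w, θ⟩, ⟨⟨hw, hθ⟩, hbw⟩, hmin⟩ := hK.exists_isMinOn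
    ⟨(w₀, Θ), ⟨hw₀, hΘ, le_rfl⟩, hbw₀⟩ (f := Prod.snd) continuous_snd.continuousOn
  obtain ⟨g, hg⟩ := exists_isFlow_cheapestPathsNetwork hst hb hθ.1
    (fun p hp => (hT p).2 ((hP p).1 hp)) hw hbw storage
  refine ⟨θ, g, hg, fun θ' g' hg' => ?_⟩
  have hf : D.IsFlow storage s t b θ' (extendByZero g') := hg'.extendByZero
  obtain ⟨w', hw', hbw'⟩ := hf.exists_packing inferInstance hb hst (T := T) (fun a ha => by
    rw [extendByZero_of_notMem g']
    rw [mem_cheapestArcs]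
    rintro ⟨p, hp, hap⟩
    exact ha (((hT p).1 hp).2 a hap)) hP
  rcases le_total θ' Θ with h1 | h1
  · exact hmin (a := (w', θ')) ⟨⟨hw', (hf.pos_horizon hb).le, h1⟩, hbw'⟩
  · exact hθ.2.trans h1

end MinCost

end Network

theorem mainTheorem2 {V A : Type*} [Finite V] [Fintype A] [DecidableEq V]
    (D : Network V A) (hD : D.Conservative) (storage : Bool)
    (s t : V) (hst : s ≠ t) (b : ℝ) (hb : 0 < b) :
    (∀ θ f, D.IsFlow storage s t b θ f →
      List.TFAE [
        D.IsMinCostFlow storage s t b θ f,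
        Network.SentAlong (D.amount θ f) {p | D.IsCheapestPath s t p ∨ D.IsZeroCycle p},
        ∀ a, a ∉ D.cheapestArcs s t → (¬ ∃ p, D.IsZeroCycle p ∧ a ∈ p) →
          f a =ᵐ[MeasureTheory.volume] 0]) ∧
    ((¬ ∃ p, D.IsZeroCycle p) → ∀ θ f, D.IsFlow storage s t b θ f →
      List.TFAE [
        D.IsMinCostFlow storage s t b θ f,
        Network.SentAlong (D.amount θ f) {p | D.IsCheapestPath s t p},
        ∀ a, a ∉ D.cheapestArcs s t → f a =ᵐ[MeasureTheory.volume] 0]) ∧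
    (∀ θ g, (D.cheapestPathsNetwork s t).IsQuickestFlow storage s t b θ g →
      D.IsQuickestMinCostFlow storage s t b θ (Network.extendByZero g)) ∧
    ((∃ p, D.IsPath s p t) →
      ∃ θ g, (D.cheapestPathsNetwork s t).IsQuickestFlow storage s t b θ g) := by
  refine ⟨fun θ f hf => hf.isMinCostFlow_tfae hD hst hb, fun hz θ f hf => ?_,
    fun θ g hg => hg.isQuickestMinCostFlow_extendByZero hD hst hb,
    fun h => Network.exists_isQuickestFlow_cheapestPathsNetwork hD hst hb h storage⟩
  have hz' : ∀ p, ¬ D.IsZeroCycle p := fun p hp => hz ⟨p, hp⟩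
  simpa [hz'] using hf.isMinCostFlow_tfae hD hst hb
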